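/- **Theorem 2.** An instance of a $p$-objective minimization problem ($p\ge 1$) consists of a finite or infinite set $X$ of feasible solutions and objective functions $f_1,\dots,f_p : X\to\mathbb{Q}_{>0}$. For $\alpha\in[1,\infty)^p$, a solution $x$ is said to $\alpha$-approximate a solution $x'$ if $f_i(x)\le \alpha_i f_i(x')$ for all $i$. For $\varepsilon>0$ consider the following relations on $X$: - $(1+\varepsilon)$-dominance: $x$ $\alpha$-approximates $x'$ with $\alpha_i=1+\varepsilon$ for all $i$; - one-exact $(1+\varepsilon)$-dominance: $x$ $\alpha$-approximates $x'$ with $\alpha_1=1$ and $\alpha_i=1+\varepsilon$ for all $i\ge 2$; - quasi-$k$-exact $(1+\varepsilon)$-dominance: $x$ $\alpha$-approximates $x'$ for some $\alpha$ with $k$ components equal to $1$ and the other $p-k$ components equal to $1+\varepsilon$ (which components equal $1$ may depend on $x$ and $x'$). For a relation $R$ on $X$, an $R$-approximation set is a set $P\subseteq X$ such that for every $x'\in X$ there is $x\in P$ with $x\,R\,x'$. For every $p\ge 1$ there is a constant $C>0$, depending only on $p$, such that the following holds for every instance $(X,f)$ with $p$ objectives, every $M\in\mathbb{N}$ such that all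 values $f_i(x)$ have binary encoding length at most $M$ (number of binary digits of the numerator plus that of the denominator, in lowest terms), and every $\varepsilon>0$: there exists a finite $R$-approximation set $P$ with $$|P|\;\le\; C\left(\frac{M}{\min\{\varepsilon,1\}}\right)^{p-1}$$ 1. for $R$ the $(1+\varepsilon)$-dominance relation, 2. for $R$ the one-exact $(1+\varepsilon)$-dominance relation, 3. for $R$ the quasi-$k$-exact $(1+\varepsilon)$-dominance relation, for every integer $0\le k\le\lceil p/2\rceil$. In particular, for $0<\varepsilon\le 1$ the cardinality is at most $C\,(M/\varepsilon)^{p-1}$, i.e. $\mathcal{O}((M/\varepsilon)^{p-1})$. -/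

import Mathlib

universe u

/-- Length of the binary encoding of a positive rational number, written in lowest terms:
the number of binary digits of the numerator plus that of the denominator. -/
def encLength (q : ℚ) : ℕ :=
  Nat.size q.num.natAbs + Nat.size q.den

/-- An instance of a `p`-objective minimization problem: an arbitrary (finite or infinite) set `X`
of feasible solutions, and `p` objective functions with positive rational values. -/
structure MOInstance (p : ℕ) : Type (u + 1) where
  X : Type u
  f : Fin p → X → ℚ
  f_pos : ∀ i x, 0 < f i x

namespace MOInstance

/-- `M` bounds the binary encoding length of every objective value of the instance. -/
def EncodingBound {p : ℕ} (I : MOInstance.{u} p) (M : ℕ) : Prop :=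
  ∀ (i : Fin p) (x : I.X), encLength (I.f i x) ≤ M

/-- The solution `x` `α`-approximates the solution `x'`. -/
def Approximates {p : ℕ} (I : MOInstance.{u} p) (α : Fin p → ℝ) (x x' : I.X) : Prop :=
  ∀ i : Fin p, (I.f i x : ℝ) ≤ α i * (I.f i x' : ℝ)

/-- `(1+ε)`-dominance. -/
def Dom {p : ℕ} (I : MOInstance.{u} p) (ε : ℝ) (x x' : I.X) : Prop :=
  I.Approximates (fun _ => 1 + ε) x x'

/-- One-exact `(1+ε)`-dominance: the factor of the first objective (index `0`) is `1`. -/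
def OneExactDom {p : ℕ} (I : MOInstance.{u} p) (ε : ℝ) (x x' : I.X) : Prop :=
  I.Approximates (fun i => if (i : ℕ) = 0 then 1 else 1 + ε) x x'

/-- Quasi-`k`-exact `(1+ε)`-dominance: `k` of the factors are `1`, the other `p - k` are `1+ε`;
the choice of the `k` objectives may depend on the pair of solutions. -/
def QuasiExactDom {p : ℕ} (I : MOInstance.{u} p) (k : ℕ) (ε : ℝ) (x x' : I.X) : Prop :=
  ∃ S : Finset (Fin p), S.card = k ∧
    I.Approximates (fun i => if i ∈ S then 1 else 1 + ε) x x'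

/-- `P` is an `R`-approximation set: every feasible solution is `R`-dominated by one in `P`. -/
def IsApproxSet {p : ℕ} (I : MOInstance.{u} p) (R : I.X → I.X → Prop) (P : Set I.X) : Prop :=
  ∀ x' : I.X, ∃ x ∈ P, R x x'

end MOInstance

/-! Cut the objective space into boxes with ratio `1 + ε`; along each axis only O(M/ε) boxes occur.
For one-exact dominance, fix the boxes of all objectives but the first and take a minimizer of the
first. For quasi-exact dominance, group the boxes into O((M/ε)^(p-1)) diagonals. A solution in the
lowest nonempty box of a diagonal is strictly better in every objective than any solution in a
higher box, so only that lowest box matters. Inside it any two solutions are within `1 + ε`, and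
what remains is to be at least as good in `k` objectives.

For `k ≤ ⌈p/2⌉` that relation is total, and a bounded number of solutions dominate all others: by
minimax some probability weight puts mass at least 1/2 on the dominators of each point, by
pigeonhole one set of `k` coordinates keeps a constant share of it, and orthants of constant mass
have nets of bounded size. -/

/-! ### Minimax, orthant nets and majority relations -/

open Finset in
/-- A symmetric zero-sum game has a strategy with nonnegative guaranteed payoff. -/
theorem exists_stdSimplex_nonneg_of_skew {ι : Type*} [Fintype ι] [Nonempty ι]
    (a : ι → ι → ℝ) (ha : ∀ u v, a v u = -a u v) :
    ∃ w ∈ stdSimplex ℝ ι, ∀ v, 0 ≤ ∑ u, a v u * w u := by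
  classical
  by_contra! hcon
  let T : (ι → ℝ) →ₗ[ℝ] (ι → ℝ) := Matrix.mulVecLin (Matrix.of a)
  have hT : ∀ w v, T w v = ∑ u, a v u * w u := fun w v => rfl
  have hKc : IsCompact (T '' stdSimplex ℝ ι) :=
    (isCompact_stdSimplex ℝ ι).image T.continuous_of_finiteDimensional
  have hKv : Convex ℝ (T '' stdSimplex ℝ ι) := (convex_stdSimplex ℝ ι).linear_image T
  have hdisj : Disjoint (T '' stdSimplex ℝ ι) (Set.Ici (0 : ι → ℝ)) := by
    rw [Set.disjoint_left]
    rintro _ ⟨w, hw, rfl⟩ hmem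
    obtain ⟨v, hv⟩ := hcon w hw
    have := hmem v
    rw [hT] at this
    exact absurd this (not_le.mpr hv)
  obtain ⟨l, r, s, hlr, hrs, hsl⟩ :=
    geometric_hahn_banach_compact_closed hKv hKc (convex_Ici 0) isClosed_Ici hdisj
  have hs : s < 0 := by simpa using hsl 0 (by simp)
  let c : ι → ℝ := fun i => l (Pi.single i 1)
  have hl : ∀ y : ι → ℝ, l y = ∑ i, y i * c i := by
    intro y
    conv_lhs => rw [pi_eq_sum_univ' y]
    simp only [map_sum, map_smul, smul_eq_mul, c]
  have hc : ∀ i, 0 ≤ c i := by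
    intro i
    by_contra! hneg
    -- This multiple lies in the nonnegative orthant, yet `l` takes exactly the value `s` on it.
    have h1 := hsl ((s / c i) • Pi.single i 1) (by
      intro j
      have : 0 ≤ s / c i := (div_pos_of_neg_of_neg hs hneg).le
      by_cases hj : j = i
      · subst hj; simpa using this
      · simp [hj])
    rw [map_smul, smul_eq_mul] at h1
    change s < s / c i * c i at h1
    rw [div_mul_cancel₀ _ hneg.ne] at h1
    exact lt_irrefl _ h1
  have hskew : ∑ v, (∑ u, a v u * c u) * c v = 0 := by
    have h1 : ∑ v, (∑ u, a v u * c u) * c v = -∑ v, (∑ u, a v u * c u) * c v := by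
      conv_lhs =>
        simp only [sum_mul]
        rw [sum_comm]
      rw [← sum_neg_distrib]
      refine sum_congr rfl fun v _ => ?_
      rw [sum_mul, ← sum_neg_distrib]
      refine sum_congr rfl fun u _ => ?_
      rw [ha v u]
      ring
    linarith
  have hsum : 0 < ∑ i, c i := by
    refine lt_of_le_of_ne (sum_nonneg fun i _ => hc i) fun h0 => ?_
    have hc0 : ∀ i, c i = 0 := fun i =>
      (sum_eq_zero_iff_of_nonneg fun i _ => hc i).mp h0.symm i (mem_univ i)
    obtain ⟨i⟩ := ‹Nonempty ι›
    have h1 := hlr _ ⟨_, single_mem_stdSimplex ℝ i, rfl⟩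
    rw [hl] at h1
    simp only [hc0, mul_zero, sum_const_zero] at h1
    linarith
  -- The normalized separating functional is itself a strategy; skew symmetry makes `l` vanish on
  -- its image, where it should be negative.
  have h2 := hlr _ ⟨(∑ i, c i)⁻¹ • c, ⟨fun i => mul_nonneg (inv_nonneg.mpr hsum.le) (hc i), by
    simp [← mul_sum, hsum.ne']⟩, rfl⟩
  rw [map_smul, map_smul, hl] at h2
  simp only [hT, hskew, smul_zero] at h2
  linarith

open Finset in
/-- A finite total relation has a probability weight under which every element is dominated by at
least half of the mass. -/
theorem exists_weight_half_le_of_total {V : Type*} [Fintype V] [Nonempty V]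
    (R : V → V → Prop) [DecidableRel R] (hR : ∀ u v, R u v ∨ R v u) :
    ∃ w : V → ℝ, (∀ u, 0 ≤ w u) ∧ ∑ u, w u = 1 ∧ ∀ v, 1 / 2 ≤ ∑ u with R u v, w u := by
  obtain ⟨w, ⟨hw0, hw1⟩, hw⟩ := exists_stdSimplex_nonneg_of_skew
    (fun v u : V => (if R u v then (1 : ℝ) else 0) - if R v u then 1 else 0)
    (fun u v => by ring)
  refine ⟨w, hw0, hw1, fun v => ?_⟩
  have h := hw v
  -- By totality, 1 ≤ [R u v] + [R v u], hence 1 + [R u v] - [R v u] ≤ 2 [R u v].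
  have : ∑ u, (w u + ((if R u v then (1 : ℝ) else 0) - if R v u then 1 else 0) * w u)
      ≤ ∑ u, 2 * (if R u v then w u else 0) := by
    refine sum_le_sum fun u _ => ?_
    have := hw0 u
    have := hR u v
    split_ifs <;> first | linarith | tauto
  rw [sum_add_distrib, hw1, ← mul_sum, ← sum_filter] at this
  linarith

open Finset in
/-- Orthants have weak nets of size independent of the ground set: for the coordinates in `S` and
`δ > 0` some `D` bounds the size of a set that meets every orthant of weight at least `δ`. -/
theorem exists_orthant_net.{v} {ι : Type*} (S : Finset ι) : ∀ δ : ℝ, 0 < δ →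
    ∃ D : ℕ, ∀ (V : Type v) (A : Finset V) (g : ι → V → ℚ) (w : V → ℝ),
      (∀ u, 0 ≤ w u) → ∑ u ∈ A, w u ≤ 1 → ∃ N ⊆ A, N.card ≤ D ∧
        ∀ t : ι → ℚ, δ ≤ ∑ u ∈ A with ∀ i ∈ S, g i u ≤ t i, w u →
          ∃ u ∈ N, ∀ i ∈ S, g i u ≤ t i := by
  classical
  induction S using Finset.induction_on with
  | empty =>
    intro δ hδ
    refine ⟨1, fun V A g w hw hA => ?_⟩
    rcases A.eq_empty_or_nonempty with rfl | ⟨a, ha⟩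
    · exact ⟨∅, Subset.rfl, by simp, fun t ht => by simp at ht; linarith⟩
    · exact ⟨{a}, by simpa using ha, by simp, fun t _ => ⟨a, by simp, by simp⟩⟩
  | insert i S _ ih =>
    intro δ hδ
    obtain ⟨D, hD⟩ := ih (δ / 2) (half_pos hδ)
    -- Thresholds `t i` are sorted by the mass below them into slabs of width `δ / 2`, with one net
    -- for the remaining coordinates per slab.
    refine ⟨(⌊2 / δ⌋₊ + 1) * D, fun V A g w hw hA => ?_⟩
    have hmax : ∀ t : ι → ℚ, δ ≤ ∑ u ∈ A with ∀ l ∈ insert i S, g l u ≤ t l, w u →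
        ∃ b ∈ A, g i b ≤ t i ∧
          ∑ u ∈ A with g i u ≤ t i, w u = ∑ u ∈ A with g i u ≤ g i b, w u := by
      intro t h3
      have hne : (A.filter fun u => g i u ≤ t i).Nonempty := by
        by_contra hem
        rw [not_nonempty_iff_eq_empty] at hem
        have : A.filter (fun u => ∀ l ∈ insert i S, g l u ≤ t l) ⊆ ∅ := by
          rw [← hem]
          exact fun u hu => mem_filter.mpr ⟨(mem_filter.mp hu).1,
            (mem_filter.mp hu).2 i (mem_insert_self _ _)⟩
        rw [subset_empty.mp this, sum_empty] at h3
        linarith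
      obtain ⟨b, hb, hbmax⟩ := exists_max_image _ (g i) hne
      rw [mem_filter] at hb
      exact ⟨b, hb.1, hb.2, sum_congr (filter_congr fun u hu => ⟨fun h =>
        hbmax u (mem_filter.mpr ⟨hu, h⟩), fun h => h.trans hb.2⟩) fun _ _ => rfl⟩
    have key : ∀ j : ℕ, ∃ N ⊆ A, N.card ≤ D ∧ ∀ t : ι → ℚ,
        j * (δ / 2) ≤ ∑ u ∈ A with g i u ≤ t i, w u →
        ∑ u ∈ A with g i u ≤ t i, w u < (j + 1) * (δ / 2) →
        δ ≤ ∑ u ∈ A with ∀ l ∈ insert i S, g l u ≤ t l, w u →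
        ∃ u ∈ N, ∀ l ∈ insert i S, g l u ≤ t l := by
      intro j
      rcases (A.filter fun a => j * (δ / 2) ≤ ∑ u ∈ A with g i u ≤ g i a, w u).eq_empty_or_nonempty
        with hG | hG
      · refine ⟨∅, empty_subset _, by simp, fun t h1 _ h3 => ?_⟩
        exfalso
        obtain ⟨b, hbA, hbt, hbW⟩ := hmax t h3
        have : b ∈ (∅ : Finset V) := by
          rw [← hG, mem_filter]
          exact ⟨hbA, h1.trans_eq hbW⟩
        simp at this
      · obtain ⟨a, ha, hamin⟩ := exists_min_image _ (g i) hG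
        rw [mem_filter] at ha
        obtain ⟨N, hNA, hND, hN⟩ := hD V (A.filter fun u => g i u ≤ g i a) g w hw
          ((sum_le_sum_of_subset_of_nonneg (filter_subset _ _) fun u _ _ => hw u).trans hA)
        refine ⟨N, hNA.trans (filter_subset _ _), hND, fun t h1 h2 h3 => ?_⟩
        obtain ⟨b, hbA, hbt, hbW⟩ := hmax t h3
        have hat : g i a ≤ t i :=
          (hamin b (mem_filter.mpr ⟨hbA, h1.trans_eq hbW⟩)).trans hbt
        -- Lowering the threshold from `t i` to `g i a` loses less than `δ / 2`, as both lie in slab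
        -- `j`. Net points below `g i a` then satisfy coordinate `i` automatically.
        have hsplit : ∑ u ∈ A with ∀ l ∈ insert i S, g l u ≤ t l, w u
            ≤ ∑ u ∈ A.filter (fun u => g i u ≤ g i a) with ∀ l ∈ S, g l u ≤ t l, w u
              + (∑ u ∈ A with g i u ≤ t i, w u - ∑ u ∈ A with g i u ≤ g i a, w u) := by
          have e : ∑ u ∈ A with g i u ≤ t i, w u - ∑ u ∈ A with g i u ≤ g i a, w u
              = ∑ u ∈ A, ((if g i u ≤ t i then w u else 0)
                - if g i u ≤ g i a then w u else 0) := by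
            rw [sum_sub_distrib, sum_filter, sum_filter]
          rw [e, filter_filter, sum_filter, sum_filter, ← sum_add_distrib]
          refine sum_le_sum fun u _ => ?_
          have := hw u
          by_cases c1 : g i u ≤ g i a
          · have c2 := c1.trans hat
            simp [c1, c2]
          · by_cases c2 : g i u ≤ t i
            · simp only [c1, c2, mem_insert, forall_eq_or_imp, true_and, false_and, if_true,
                if_false]
              split_ifs <;> linarith
            · simp [c1, c2]
        obtain ⟨u, huN, hu⟩ := hN t (by
          have := ha.2
          nlinarith)
        refine ⟨u, huN, fun l hl => ?_⟩
        rcases mem_insert.mp hl with rfl | hl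
        · exact ((mem_filter.mp (hNA huN)).2).trans hat
        · exact hu l hl
    choose N hNA hND hN using key
    refine ⟨(range (⌊2 / δ⌋₊ + 1)).biUnion N, biUnion_subset.mpr fun j _ => hNA j,
      (card_biUnion_le_card_mul _ _ D fun j _ => hND j).trans_eq (by simp), fun t ht => ?_⟩
    set W := ∑ u ∈ A with g i u ≤ t i, w u with hW
    have hW0 : 0 ≤ W := sum_nonneg fun u _ => hw u
    have hW1 : W ≤ 1 :=
      (sum_le_sum_of_subset_of_nonneg (filter_subset _ _) fun u _ _ => hw u).trans hA
    have hδ2 := half_pos hδ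
    have hj : ⌊W / (δ / 2)⌋₊ ∈ range (⌊2 / δ⌋₊ + 1) := by
      rw [mem_range, Nat.lt_succ_iff]
      refine Nat.floor_le_floor ?_
      rw [div_le_div_iff₀ hδ2 hδ]
      nlinarith
    obtain ⟨u, hu, hut⟩ := hN ⌊W / (δ / 2)⌋₊ t
      ((le_div_iff₀ hδ2).mp (Nat.floor_le (by positivity)))
      ((div_lt_iff₀ hδ2).mp (Nat.lt_floor_add_one _)) ht
    exact ⟨u, mem_biUnion.mpr ⟨_, hj, hu⟩, hut⟩

-- Every coordinate is counted on at least one side, so the two counts sum to at least `2 * k - 1`.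
-- This is where the bound `⌈p/2⌉` comes from.
open Finset in
theorem le_card_le_or_le_card_le {ι : Type*} [Fintype ι] {k : ℕ}
    (hk : 2 * k ≤ Fintype.card ι + 1) (u v : ι → ℚ) :
    k ≤ #{i | u i ≤ v i} ∨ k ≤ #{i | v i ≤ u i} := by
  classical
  have h := card_filter_add_card_filter_not (s := (univ : Finset ι)) (fun i => u i ≤ v i)
  have h' : #{i | ¬ u i ≤ v i} ≤ #{i | v i ≤ u i} :=
    card_le_card (monotone_filter_right _ fun i _ hi => (not_le.mp hi).le)
  rw [card_univ] at h
  omega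

open Finset in
/-- Majority relations of boundedly many voters have dominating sets of bounded size. -/
theorem exists_majority_dominating.{v} (ι : Type*) [Fintype ι] :
    ∃ D : ℕ, ∀ k : ℕ, 2 * k ≤ Fintype.card ι + 1 → ∀ (V : Type v) [Finite V] (g : ι → V → ℚ),
      ∃ N : Finset V, N.card ≤ D ∧ ∀ v, ∃ u ∈ N, k ≤ #{i | g i u ≤ g i v} := by
  classical
  -- Mass 1/2 shared among at most `2 ^ card ι` coordinate sets.
  set δ : ℝ := 1 / 2 / 2 ^ Fintype.card ι with hδ
  have hδ0 : 0 < δ := by positivity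
  choose D hD using fun S : Finset ι => exists_orthant_net.{v} S δ hδ0
  refine ⟨∑ S, D S, fun k hk V _ g => ?_⟩
  cases nonempty_fintype V
  rcases isEmpty_or_nonempty V with hV | hV
  · exact ⟨∅, by simp, fun v => (hV.false v).elim⟩
  obtain ⟨w, hw0, hw1, hw⟩ := exists_weight_half_le_of_total
    (fun u v : V => k ≤ #{i | g i u ≤ g i v})
    (fun u v => le_card_le_or_le_card_le hk (fun i => g i u) (fun i => g i v))
  choose N _ hND hN using fun S => hD S V univ g w hw0 hw1.le
  refine ⟨univ.biUnion N, card_biUnion_le.trans (sum_le_sum fun S _ => hND S), fun v => ?_⟩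
  have hcover : 1 / 2 ≤ ∑ S ∈ powersetCard k (univ : Finset ι),
      ∑ u with ∀ i ∈ S, g i u ≤ g i v, w u := by
    refine (hw v).trans ?_
    rw [sum_filter]
    simp only [sum_filter]
    rw [sum_comm]
    refine sum_le_sum fun u _ => ?_
    split_ifs with h
    · obtain ⟨S, hS, hSk⟩ := exists_subset_card_eq h
      refine le_trans ?_ (single_le_sum (f := fun S : Finset ι =>
        if ∀ i ∈ S, g i u ≤ g i v then w u else 0) (fun S _ => ?_)
        (mem_powersetCard_univ.mpr hSk))
      · rw [if_pos fun i hi => (mem_filter.mp (hS hi)).2]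
      · split_ifs
        exacts [hw0 u, le_rfl]
    · exact sum_nonneg fun S _ => by
        split_ifs
        exacts [hw0 u, le_rfl]
  have hbig : ∃ S ∈ powersetCard k (univ : Finset ι),
      δ ≤ ∑ u with ∀ i ∈ S, g i u ≤ g i v, w u := by
    have hcard : (#(powersetCard k (univ : Finset ι)) : ℝ) ≤ 2 ^ Fintype.card ι := by
      have := card_le_card (subset_univ (powersetCard k (univ : Finset ι)))
      rw [card_univ, Fintype.card_finset] at this
      exact_mod_cast this
    by_contra! hlt
    have hne : (powersetCard k (univ : Finset ι)).Nonempty :=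
      nonempty_of_sum_ne_zero (ne_of_gt (lt_of_lt_of_le one_half_pos hcover))
    have h1 := sum_lt_sum_of_nonempty hne hlt
    rw [sum_const, nsmul_eq_mul] at h1
    have h2 := mul_le_mul_of_nonneg_right hcard hδ0.le
    rw [hδ, mul_div_cancel₀ _ (by positivity)] at h2
    linarith
  obtain ⟨S, hS, hSδ⟩ := hbig
  obtain ⟨u, huN, hu⟩ := hN S (fun i => g i v) (by convert hSδ)
  refine ⟨u, mem_biUnion.mpr ⟨S, mem_univ S, huN⟩, ?_⟩
  rw [← mem_powersetCard_univ.mp hS]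
  exact card_le_card fun i hi => mem_filter.mpr ⟨mem_univ i, hu i hi⟩

/-! ### Bounded encoding length, and gluing over classes -/

theorem finite_setOf_encLength_le (M : ℕ) : {q : ℚ | encLength q ≤ M}.Finite := by
  refine Set.Finite.subset (((Set.finite_Icc (-(2 ^ M : ℤ)) (2 ^ M)).prod
    (Set.finite_Iic (2 ^ M))).image fun z : ℤ × ℕ => (z.1 : ℚ) / z.2) fun q hq => ?_
  have hq' : Nat.size q.num.natAbs + Nat.size q.den ≤ M := hq
  have h1 : q.num.natAbs < 2 ^ M := Nat.size_le.mp (by omega)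
  have h2 : q.den < 2 ^ M := Nat.size_le.mp (by omega)
  refine ⟨(q.num, q.den), ⟨?_, h2.le⟩, Rat.num_div_den q⟩
  have : (q.num.natAbs : ℤ) < 2 ^ M := by exact_mod_cast h1
  constructor <;> simp only <;> omega

theorem abs_log_le_of_encLength_le {q : ℚ} (hq : 0 < q) {M : ℕ} (h : encLength q ≤ M) :
    |Real.log q| ≤ M := by
  have h' : Nat.size q.num.natAbs + Nat.size q.den ≤ M := h
  have h1 : q.num.natAbs < 2 ^ M := Nat.size_le.mp (by omega)
  have h2 : q.den < 2 ^ M := Nat.size_le.mp (by omega)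
  have hn : 0 < q.num := Rat.num_pos.mpr hq
  have hna : 0 < q.num.natAbs := by omega
  have hl : ∀ n : ℕ, 0 < n → n < 2 ^ M → 0 ≤ Real.log n ∧ Real.log n ≤ M := by
    intro n h0 hn
    refine ⟨Real.log_natCast_nonneg n, ?_⟩
    calc Real.log n ≤ Real.log (2 ^ M) :=
          Real.log_le_log (by exact_mod_cast h0) (by exact_mod_cast hn.le)
      _ = M * Real.log 2 := by rw [Real.log_pow]
      _ ≤ M * 1 := by gcongr; linarith [Real.log_two_lt_d9]
      _ = M := mul_one _
  have e : (q : ℝ) = (q.num.natAbs : ℝ) / (q.den : ℝ) := by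
    have e1 : ((q.num.natAbs : ℤ) : ℝ) = (q.num : ℝ) := by
      exact_mod_cast Int.natAbs_of_nonneg hn.le
    rw [Int.cast_natCast] at e1
    rw [e1]
    exact Rat.cast_def q
  rw [e, Real.log_div (by exact_mod_cast hna.ne') (by exact_mod_cast q.den_ne_zero), abs_le]
  obtain ⟨a1, a2⟩ := hl _ hna h1
  obtain ⟨b1, b2⟩ := hl _ q.den_pos h2
  constructor <;> linarith

/-- Local dominating sets of size at most `D`, one for each of the classes in `T`, combine to a
global one. -/
theorem exists_dominating_of_classes {X K : Type*} (T : Finset K) (c : X → K) (hc : ∀ x, c x ∈ T)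
    (R : X → X → Prop) (D : ℕ)
    (h : ∀ κ, ∃ P : Finset X, P.card ≤ D ∧ ∀ x, c x = κ → ∃ y ∈ P, R y x) :
    ∃ P : Finset X, P.card ≤ T.card * D ∧ ∀ x, ∃ y ∈ P, R y x := by
  classical
  choose P hP hPR using h
  refine ⟨T.biUnion P, Finset.card_biUnion_le_card_mul _ _ _ fun κ _ => hP κ, fun x => ?_⟩
  obtain ⟨y, hy, hyx⟩ := hPR (c x) x rfl
  exact ⟨y, Finset.mem_biUnion.mpr ⟨_, hc x, hy⟩, hyx⟩

/-! ### Boxes and the approximation sets built from them -/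

namespace MOInstance

variable {p : ℕ} (I : MOInstance.{u} p)

/-- Index of the interval `[(1+ε)^b, (1+ε)^(b+1))` that contains the `i`-th objective value. -/
noncomputable def box (ε : ℝ) (i : Fin p) (x : I.X) : ℤ :=
  ⌊Real.logb (1 + ε) (I.f i x)⌋

variable {I}

theorem lt_of_box_lt {ε : ℝ} (hε : 0 < ε) {i : Fin p} {x y : I.X}
    (h : I.box ε i x < I.box ε i y) : I.f i x < I.f i y := by
  have h1 : Real.logb (1 + ε) (I.f i x) < Real.logb (1 + ε) (I.f i y) := by
    by_contra! h2
    exact absurd (Int.floor_le_floor h2) (not_le.mpr h)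
  have := (Real.logb_lt_logb_iff (by linarith) (by exact_mod_cast I.f_pos i x)
    (by exact_mod_cast I.f_pos i y)).mp h1
  exact_mod_cast this

theorem le_mul_of_box_le {ε : ℝ} (hε : 0 < ε) {i : Fin p} {x y : I.X}
    (h : I.box ε i x ≤ I.box ε i y) : (I.f i x : ℝ) ≤ (1 + ε) * I.f i y := by
  have hx : (0 : ℝ) < I.f i x := by exact_mod_cast I.f_pos i x
  have hy : (0 : ℝ) < I.f i y := by exact_mod_cast I.f_pos i y
  have h1 : Real.logb (1 + ε) (I.f i x) ≤ 1 + Real.logb (1 + ε) (I.f i y) := by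
    have a := Int.lt_floor_add_one (Real.logb (1 + ε) (I.f i x))
    have b := Int.floor_le (Real.logb (1 + ε) (I.f i y))
    have : ((I.box ε i x : ℤ) : ℝ) ≤ I.box ε i y := by exact_mod_cast h
    unfold box at this
    linarith
  rw [← Real.logb_le_logb (b := 1 + ε) (by linarith) hx (by positivity),
    Real.logb_mul (by linarith) hy.ne', Real.logb_self_eq_one (by linarith)]
  exact h1

/-- Logarithms of values are at most `M` in absolute value, and log(1 + ε) ≥ ε/(1 + ε) ≥ ε/2 because
`ε ≤ 1`. -/
theorem abs_box_le {M : ℕ} (hM : I.EncodingBound M) {ε : ℝ} (hε : 0 < ε) (hε1 : ε ≤ 1)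
    (i : Fin p) (x : I.X) : |I.box ε i x| ≤ (⌈2 * M / ε⌉₊ : ℤ) := by
  have hlog : ε / 2 ≤ Real.log (1 + ε) := by
    refine le_trans ?_ (Real.one_sub_inv_le_log_of_pos (by linarith))
    have h1 : 1 - (1 + ε)⁻¹ = ε / (1 + ε) := by
      field_simp
      ring
    rw [h1]
    exact div_le_div_of_nonneg_left hε.le (by linarith) (by linarith)
  have hb : |Real.logb (1 + ε) (I.f i x)| ≤ 2 * M / ε := by
    have h := abs_log_le_of_encLength_le (I.f_pos i x) (hM i x)
    have hlp : 0 < Real.log (1 + ε) := by linarith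
    rw [Real.logb, abs_div, abs_of_pos hlp, div_le_div_iff₀ hlp hε]
    nlinarith [abs_nonneg (Real.log (I.f i x))]
  have hc := Nat.le_ceil (2 * M / ε)
  rw [abs_le] at hb ⊢
  unfold box
  constructor
  · rw [Int.le_floor]
    push_cast
    linarith
  · rw [← Int.floor_natCast (R := ℝ) ⌈2 * M / ε⌉₊]
    exact Int.floor_le_floor (by linarith)

/-- This is what makes minima exist when `X` is infinite. -/
theorem EncodingBound.finite_range {M : ℕ} (hM : I.EncodingBound M) :
    (Set.range fun (x : I.X) (i : Fin p) => I.f i x).Finite := by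
  refine Set.Finite.subset (Set.Finite.pi' fun _ : Fin p => finite_setOf_encLength_le M) ?_
  rintro _ ⟨x, rfl⟩ i
  exact hM i x

theorem approximates_of_eps_le {S : Fin p → Prop} [DecidablePred S] {ε ε' : ℝ} (h : ε ≤ ε')
    {x y : I.X} (hxy : I.Approximates (fun i => if S i then 1 else 1 + ε) x y) :
    I.Approximates (fun i => if S i then 1 else 1 + ε') x y := by
  intro i
  refine (hxy i).trans (mul_le_mul_of_nonneg_right ?_ (by exact_mod_cast (I.f_pos i y).le))
  simp only
  split_ifs <;> linarith

theorem OneExactDom.dom {ε : ℝ} (hε : 0 < ε) {x y : I.X} (h : I.OneExactDom ε x y) :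
    I.Dom ε x y := by
  intro i
  refine (h i).trans (mul_le_mul_of_nonneg_right ?_ (by exact_mod_cast (I.f_pos i y).le))
  simp only
  split_ifs <;> linarith

/-- A set of solutions with finitely many objective vectors has a minimum for every score in
a linear order that depends on the objective vector only. -/
theorem EncodingBound.exists_min {M : ℕ} (hM : I.EncodingBound M) {α : Type*} [LinearOrder α]
    (φ : (Fin p → ℚ) → α) {s : Set I.X} (hs : s.Nonempty) :
    ∃ x ∈ s, ∀ y ∈ s, φ (fun i => I.f i x) ≤ φ (fun i => I.f i y) := by
  obtain ⟨_, ⟨x, hx, rfl⟩, hmin⟩ := Set.exists_min_image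
    ((fun (x : I.X) (i : Fin p) => I.f i x) '' s) φ
    (hM.finite_range.subset (Set.image_subset_range _ _)) (hs.image _)
  exact ⟨x, hx, fun y hy => hmin _ ⟨y, hy, rfl⟩⟩

theorem EncodingBound.exists_oneExact {n : ℕ} {I : MOInstance.{u} (n + 1)} {M : ℕ}
    (hM : I.EncodingBound M) {ε : ℝ} (hε : 0 < ε) {L : ℕ}
    (hL : ∀ i x, |I.box ε i x| ≤ (L : ℤ)) :
    ∃ P : Finset I.X, P.card ≤ (4 * L + 1) ^ n ∧ I.IsApproxSet (I.OneExactDom ε) P := by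
  classical
  obtain ⟨P, hP, hR⟩ := exists_dominating_of_classes
    -- Radius `L` would do; `2 * L` gives the same count as for the index differences in the
    -- quasi-exact case.
    (Fintype.piFinset fun _ : Fin n => Finset.Icc (-(2 * L : ℤ)) (2 * L))
    (fun (x : I.X) (i : Fin n) => I.box ε i.succ x)
    (fun x => by
      rw [Fintype.mem_piFinset]
      intro i
      have := abs_le.mp (hL i.succ x)
      rw [Finset.mem_Icc]
      omega)
    (I.OneExactDom ε) 1 (fun κ => by
      rcases Set.eq_empty_or_nonempty {x : I.X | (fun i : Fin n => I.box ε i.succ x) = κ}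
        with h | h
      · exact ⟨∅, by simp, fun x hx =>
          (Set.eq_empty_iff_forall_notMem.mp h x hx).elim⟩
      · obtain ⟨y, hy, hmin⟩ := hM.exists_min (fun v => v 0) h
        refine ⟨{y}, by simp, fun x hx => ⟨y, by simp, fun i => ?_⟩⟩
        refine Fin.cases ?_ (fun i => ?_) i
        · simpa using hmin x hx
        · simpa using le_mul_of_box_le hε (congrFun (hy.trans hx.symm) i).le)
  refine ⟨P, hP.trans_eq ?_, fun x => by simpa using hR x⟩
  rw [Fintype.card_piFinset]
  simp only [Int.card_Icc, Finset.prod_const, Finset.card_univ, Fintype.card_fin, mul_one]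
  congr 1
  omega

theorem quasiExactDom_of_le_card {k : ℕ} {ε : ℝ} {x y : I.X}
    (hk : k ≤ (Finset.univ.filter fun i => I.f i x ≤ I.f i y).card)
    (h : I.Dom ε x y) : I.QuasiExactDom k ε x y := by
  obtain ⟨S, hS, hSk⟩ := Finset.exists_subset_card_eq hk
  refine ⟨S, hSk, fun i => ?_⟩
  by_cases hi : i ∈ S
  · have := (Finset.mem_filter.mp (hS hi)).2
    simp only [hi, if_true, one_mul]
    exact_mod_cast this
  · simpa [hi] using h i

/-- Diagonal classes of boxes: in each one, a bounded dominating set for the majority relation on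
the lowest nonempty box suffices. -/
theorem EncodingBound.exists_quasiExact {n : ℕ} {I : MOInstance.{u} (n + 1)} {M : ℕ}
    (hM : I.EncodingBound M) {ε : ℝ} (hε : 0 < ε) {L : ℕ}
    (hL : ∀ i x, |I.box ε i x| ≤ (L : ℤ)) {k D : ℕ} (hk : k ≤ n + 1)
    (hD : ∀ (V : Type) [Finite V] (g : Fin (n + 1) → V → ℚ), ∃ N : Finset V, N.card ≤ D ∧
      ∀ v, ∃ u ∈ N, k ≤ (Finset.univ.filter fun i => g i u ≤ g i v).card) :
    ∃ P : Finset I.X, P.card ≤ (4 * L + 1) ^ n * D ∧ I.IsApproxSet (I.QuasiExactDom k ε) P := by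
  classical
  obtain ⟨P, hP, hR⟩ := exists_dominating_of_classes
    (Fintype.piFinset fun _ : Fin n => Finset.Icc (-(2 * L : ℤ)) (2 * L))
    (fun (x : I.X) (i : Fin n) => I.box ε i.succ x - I.box ε 0 x)
    (fun x => by
      rw [Fintype.mem_piFinset]
      intro i
      have := abs_le.mp (hL i.succ x)
      have := abs_le.mp (hL 0 x)
      rw [Finset.mem_Icc]
      omega)
    (I.QuasiExactDom k ε) D (fun κ => by
      set s := {x : I.X | (fun i : Fin n => I.box ε i.succ x - I.box ε 0 x) = κ} with hs
      rcases s.eq_empty_or_nonempty with h | h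
      · exact ⟨∅, by simp, fun x hx =>
          (Set.eq_empty_iff_forall_notMem.mp h x hx).elim⟩
      obtain ⟨z, hz, hmin⟩ := hM.exists_min
        (fun v => ⌊Real.logb (1 + ε) (v 0)⌋) h
      change ∀ y ∈ s, I.box ε 0 z ≤ I.box ε 0 y at hmin
      set s₀ := {x ∈ s | I.box ε 0 x = I.box ε 0 z} with hs₀
      have hbox : ∀ x ∈ s, ∀ y ∈ s, ∀ i, I.box ε i x - I.box ε 0 x
          = I.box ε i y - I.box ε 0 y := by
        intro x hx y hy i
        refine Fin.cases (by simp) (fun i => ?_) i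
        exact congrFun (hx.trans hy.symm) i
      -- The majority lemma is applied to objective vectors: they are finite in number and live in
      -- `Type`, whatever the universe of `X`.
      have hfin : Finite ((fun (x : I.X) (i : Fin (n + 1)) => I.f i x) '' s₀) :=
        hM.finite_range.subset (Set.image_subset_range _ _)
      obtain ⟨N, hND, hN⟩ := hD ((fun (x : I.X) (i : Fin (n + 1)) => I.f i x) '' s₀)
        (fun i v => v.1 i)
      choose r hr using fun v : ((fun (x : I.X) (i : Fin (n + 1)) => I.f i x) '' s₀) => v.2
      refine ⟨N.image r, Finset.card_image_le.trans hND, fun x hx => ?_⟩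
      change x ∈ s at hx
      rcases (hmin x hx).eq_or_lt with h0 | h0
      · obtain ⟨v, hv, hvk⟩ := hN ⟨_, x, ⟨hx, h0.symm⟩, rfl⟩
        have hfv : ∀ i, v.1 i = I.f i (r v) := fun i => (congrFun (hr v).2 i).symm
        refine ⟨r v, Finset.mem_image_of_mem _ hv, quasiExactDom_of_le_card ?_ fun i => ?_⟩
        · simpa only [hfv] using hvk
        · refine le_mul_of_box_le hε ?_
          have h1 := hbox _ (hr v).1.1 x hx i
          have h2 : I.box ε 0 (r v) = I.box ε 0 z := (hr v).1.2
          omega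
      -- For `x` in a higher box any chosen point works; `z` only shows that `N` is nonempty.
      · obtain ⟨v, hv, -⟩ := hN ⟨_, z, ⟨hz, rfl⟩, rfl⟩
        have hlt : ∀ i, I.box ε i (r v) < I.box ε i x := by
          intro i
          have h1 := hbox _ (hr v).1.1 x hx i
          have h2 : I.box ε 0 (r v) = I.box ε 0 z := (hr v).1.2
          omega
        refine ⟨r v, Finset.mem_image_of_mem _ hv, quasiExactDom_of_le_card ?_ fun i =>
          le_mul_of_box_le hε (hlt i).le⟩
        rw [Finset.filter_true_of_mem fun i _ => (lt_of_box_lt hε (hlt i)).le]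
        simpa using hk)
  refine ⟨P, hP.trans_eq ?_, fun x => by simpa using hR x⟩
  rw [Fintype.card_piFinset]
  simp only [Int.card_Icc, Finset.prod_const, Finset.card_univ, Fintype.card_fin]
  congr 2
  omega

end MOInstance

/-! ### Assembly and constants -/

/-- For every number `p ≥ 1` of objectives there is a constant `C`, depending on `p` only, that
bounds the three kinds of approximation sets on all instances, for all `M` and all `ε > 0`. -/
theorem theorem2 (p : ℕ) (hp : 1 ≤ p) :
    ∃ C : ℝ, 0 < C ∧
      ∀ (I : MOInstance.{u} p) (M : ℕ), I.EncodingBound M →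
        ∀ ε : ℝ, 0 < ε →
          (∃ P : Finset I.X, I.IsApproxSet (I.Dom ε) (P : Set I.X) ∧
            (P.card : ℝ) ≤ C * ((M : ℝ) / min ε 1) ^ (p - 1)) ∧
          (∃ P : Finset I.X, I.IsApproxSet (I.OneExactDom ε) (P : Set I.X) ∧
            (P.card : ℝ) ≤ C * ((M : ℝ) / min ε 1) ^ (p - 1)) ∧
          (∀ k : ℕ, k ≤ ⌈(p : ℝ) / 2⌉₊ →
            ∃ P : Finset I.X, I.IsApproxSet (I.QuasiExactDom k ε) (P : Set I.X) ∧
              (P.card : ℝ) ≤ C * ((M : ℝ) / min ε 1) ^ (p - 1)) := by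
  obtain ⟨n, rfl⟩ : ∃ n, p = n + 1 := ⟨p - 1, by omega⟩
  obtain ⟨D, hD⟩ := exists_majority_dominating.{0} (Fin (n + 1))
  refine ⟨13 ^ n * (D + 1), by positivity, fun I M hM ε hε => ?_⟩
  -- `M = 0` is possible only for empty `X`; otherwise a denominator has a digit, so `1 ≤ M`.
  rcases isEmpty_or_nonempty I.X with hX | ⟨⟨x₀⟩⟩
  · have hnn : (0 : ℝ) ≤ 13 ^ n * (D + 1) * ((M : ℝ) / min ε 1) ^ (n + 1 - 1) := by positivity
    exact ⟨⟨∅, fun x => hX.elim x, by simpa using hnn⟩, ⟨∅, fun x => hX.elim x, by simpa using hnn⟩,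
      fun k _ => ⟨∅, fun x => hX.elim x, by simpa using hnn⟩⟩
  set e := min ε 1 with he
  have he0 : 0 < e := lt_min hε one_pos
  have he1 : e ≤ 1 := min_le_right _ _
  have heε : e ≤ ε := min_le_left _ _
  have hM1 : (1 : ℝ) ≤ M := by
    have h1 := hM 0 x₀
    have h2 : 0 < Nat.size (I.f 0 x₀).den := Nat.size_pos.mpr (I.f 0 x₀).den_pos
    unfold encLength at h1
    exact_mod_cast (by omega : 1 ≤ M)
  have hMe : 1 ≤ M / e := by
    rw [le_div_iff₀ he0]
    linarith
  set L := ⌈2 * M / e⌉₊ with hLdef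
  have hL : ∀ i x, |I.box e i x| ≤ (L : ℤ) := MOInstance.abs_box_le hM he0 he1
  -- 4(2M/e + 1) + 1 = 8M/e + 5, and 1 ≤ M/e absorbs the 5.
  have hLle : ((4 * L + 1 : ℕ) : ℝ) ≤ 13 * (M / e) := by
    have h1 : (L : ℝ) < 2 * M / e + 1 := Nat.ceil_lt_add_one (by positivity)
    rw [mul_div_assoc] at h1
    push_cast
    linarith
  have hcard : ∀ c d : ℕ, d ≤ D + 1 → c ≤ (4 * L + 1) ^ n * d →
      (c : ℝ) ≤ 13 ^ n * (D + 1) * ((M : ℝ) / e) ^ (n + 1 - 1) := by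
    intro c d hd hc
    have hd' : (d : ℝ) ≤ D + 1 := by exact_mod_cast hd
    calc (c : ℝ) ≤ ((4 * L + 1 : ℕ) : ℝ) ^ n * d := by exact_mod_cast hc
      _ ≤ (13 * (M / e)) ^ n * (D + 1) := by gcongr
      _ = 13 ^ n * (D + 1) * ((M : ℝ) / e) ^ (n + 1 - 1) := by
        rw [mul_pow, Nat.add_sub_cancel]
        ring
  obtain ⟨P, hPc, hP⟩ := hM.exists_oneExact he0 hL
  have hP' : I.IsApproxSet (I.OneExactDom ε) P := fun x =>
    (hP x).imp fun y hy => ⟨hy.1, MOInstance.approximates_of_eps_le heε hy.2⟩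
  have hPcard := hcard P.card 1 (by omega) (by simpa using hPc)
  refine ⟨⟨P, fun x => (hP' x).imp fun y hy => ⟨hy.1, hy.2.dom hε⟩, hPcard⟩,
    ⟨P, hP', hPcard⟩, fun k hk => ?_⟩
  have hk2 : 2 * k ≤ n + 1 + 1 := by
    have h1 : (k : ℝ) < ((n + 1 : ℕ) : ℝ) / 2 + 1 :=
      lt_of_le_of_lt (by exact_mod_cast hk) (Nat.ceil_lt_add_one (by positivity))
    have h2 : ((2 * k : ℕ) : ℝ) < ((n + 1 + 2 : ℕ) : ℝ) := by
      push_cast at h1 ⊢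
      linarith
    have : 2 * k < n + 1 + 2 := by exact_mod_cast h2
    omega
  obtain ⟨Q, hQc, hQ⟩ := hM.exists_quasiExact he0 hL (k := k) (D := D) (by omega)
    (fun V _ g => hD k (by simpa using hk2) V g)
  refine ⟨Q, fun x => (hQ x).imp fun y hy => ⟨hy.1, ?_⟩, hcard _ D (by omega) hQc⟩
  obtain ⟨S, hS, hSa⟩ := hy.2
  exact ⟨S, hS, MOInstance.approximates_of_eps_le heε hSa⟩
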